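/- Let $\mathbf\Omega$ be the dendroidal category: its objects are finite rooted (non-planar) trees, forming a small set that contains every such tree up to isomorphism, and a morphism $S\to T$ is a morphism of the coloured symmetric operads $\Omega(S)\to\Omega(T)$. Here $\Omega(T)$ has the edges of $T$ as objects and exactly one operation $(e_1,\dots,e_n)\to e$ if $e_1,\dots,e_n$ lists without repetition the leaves of a subtree of $T$ with root $e$, and none otherwise. The edges of $T$ are partially ordered by: $e\le f$ if the path from $e$ to the root $r_T$ contains $f$. Let $\mathbf{dSets}$ be the category of presheaves of sets on $\mathbf\Omega$, and let $\mathcal N_d(P)=\mathsf{Op}(\Omega(-),P)$ be the dendroidal nerve of an operad $P$ in sets. For a dendroidal set $X$, let the operad of elements $\mathbf\Omega/X$ be the following operad. Its objects are the pairs $(T,\alpha)$ with $T$ a tree and $\alpha\in X_T$. An operation $(S_1,\alpha_1),\dots,(S_n,\alpha_n)\to(R,\beta)$ is a family of morphisms of trees $f_i\colon S_i\to R$ with $\beta\circ f_i=\alpha_i$ for all $i$ that is - independent: for $i\ne j$ and all edges $e$ of $S_i$ and $e'$ of $S_j$, the edges $f_i(e)$ and $f_j(e')$ of $R$ are incomparable;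 and - wide: $\Omega(R)(f_1(r_{S_1}),\dots,f_n(r_{S_n});r_R)\neq\emptyset$. Composition is composition of morphisms of trees. There are two conventions for $n=0$: either the empty family is not admitted at all, or it is admitted (it is then wide precisely when $R$ has no leaves). The statement below holds under each of them. A monomorphism $A\to B$ of dendroidal sets is normal if, for every tree $T$, the group $\mathrm{Aut}(T)$ acts freely on the complement of the image of $A_T$ in $B_T$. Then the endofunctor $X\mapsto\mathcal N_d(\mathbf\Omega/X)$ of $\mathbf{dSets}$ is cocontinuous (it preserves all small colimits); it is the left Kan extension, along the Yoneda embedding $\mathbf\Omega\to\mathbf{dSets}$, of its restriction to representables (with the identity as unit); and it sends normal monomorphisms to normal monomorphisms. -/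

import Mathlib

open CategoryTheory CategoryTheory.Limits Opposite

universe u v u' v' u'' v''

namespace Dendroidal

/-! ### Coloured symmetric operads in sets -/

/-- The reindexing of the inputs of `comp f (fun i => act (τ i) (g i))`. -/
def sumEquiv {n : ℕ} {m m' : Fin n → ℕ} (τ : ∀ i, Fin (m' i) ≃ Fin (m i)) :
    Fin (∑ i, m' i) ≃ Fin (∑ i, m i) :=
  finSigmaFinEquiv.symm.trans ((Equiv.sigmaCongrRight τ).trans finSigmaFinEquiv)

/-- The block permutation: the reindexing of the inputs of `comp (act σ f) (fun i => g (σ i))`. -/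
def blockEquiv {n n' : ℕ} (m : Fin n → ℕ) (σ : Fin n' ≃ Fin n) :
    Fin (∑ i, m (σ i)) ≃ Fin (∑ i, m i) :=
  finSigmaFinEquiv.symm.trans
    ((Equiv.sigmaCongrLeft (β := fun i => Fin (m i)) σ).trans finSigmaFinEquiv)

/-- The order preserving bijection between the inputs of `f ∘ (g ∘ h)` and of `(f ∘ g) ∘ h`. -/
def assocEquiv {n : ℕ} (m : Fin n → ℕ) (l : ∀ i, Fin (m i) → ℕ) :
    Fin (∑ p : Fin (∑ i, m i), l (finSigmaFinEquiv.symm p).1 (finSigmaFinEquiv.symm p).2) ≃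
      Fin (∑ i, ∑ j, l i j) :=
  finSigmaFinEquiv.symm.trans <|
    (Equiv.sigmaCongrLeft (β := fun q : (Σ i, Fin (m i)) => Fin (l q.1 q.2))
      finSigmaFinEquiv.symm).trans <|
    (Equiv.sigmaAssoc (fun i (j : Fin (m i)) => Fin (l i j))).trans <|
    (Equiv.sigmaCongrRight (fun _ => finSigmaFinEquiv)).trans finSigmaFinEquiv

/-- The identification of the inputs of `comp (one d) (fun _ => f)` with those of `f`. -/
def oneCompEquiv (m : ℕ) : Fin (∑ _i : Fin 1, m) ≃ Fin m :=
  finSigmaFinEquiv.symm.trans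
    { toFun := fun q => q.2
      invFun := fun x => ⟨0, x⟩
      left_inv := fun ⟨i, x⟩ => by rw [Subsingleton.elim i 0]
      right_inv := fun _ => rfl }

/-- The identification of the inputs of `comp f (fun i => one (c i))` with those of `f`. -/
def compOneEquiv (n : ℕ) : Fin (∑ _i : Fin n, 1) ≃ Fin n :=
  finSigmaFinEquiv.symm.trans (Equiv.sigmaUnique (Fin n) (fun _ => Fin 1))

theorem sumEquiv_spec {n : ℕ} {m m' : Fin n → ℕ} (τ : ∀ i, Fin (m' i) ≃ Fin (m i))
    (p : Fin (∑ i, m' i)) :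
    finSigmaFinEquiv.symm (sumEquiv τ p) =
      ⟨(finSigmaFinEquiv.symm p).1, τ _ (finSigmaFinEquiv.symm p).2⟩ :=
  finSigmaFinEquiv.symm_apply_apply _

theorem blockEquiv_spec {n n' : ℕ} (m : Fin n → ℕ) (σ : Fin n' ≃ Fin n)
    (p : Fin (∑ i, m (σ i))) :
    finSigmaFinEquiv.symm (blockEquiv m σ p) =
      ⟨σ (finSigmaFinEquiv.symm p).1, (finSigmaFinEquiv.symm p).2⟩ :=
  finSigmaFinEquiv.symm_apply_apply _

theorem assocEquiv_spec {n : ℕ} (m : Fin n → ℕ) (l : ∀ i, Fin (m i) → ℕ)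
    (p : Fin (∑ p : Fin (∑ i, m i),
      l (finSigmaFinEquiv.symm p).1 (finSigmaFinEquiv.symm p).2)) :
    (⟨(finSigmaFinEquiv.symm (assocEquiv m l p)).1,
      finSigmaFinEquiv.symm (finSigmaFinEquiv.symm (assocEquiv m l p)).2⟩ :
        Σ i, Σ j, Fin (l i j)) =
      ⟨(finSigmaFinEquiv.symm (finSigmaFinEquiv.symm p).1).1,
        (finSigmaFinEquiv.symm (finSigmaFinEquiv.symm p).1).2, (finSigmaFinEquiv.symm p).2⟩ :=
  (congrArg (fun s : (Σ i, Fin (∑ j, l i j)) =>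
      (⟨s.1, finSigmaFinEquiv.symm s.2⟩ : Σ i, Σ j, Fin (l i j)))
    (finSigmaFinEquiv.symm_apply_apply _)).trans
    (congrArg (Sigma.mk _) (finSigmaFinEquiv.symm_apply_apply _))

/-- A (discrete) operad: a coloured symmetric operad in sets. For `c = (c₁, …, cₙ)` the set of
operations `P(c₁, …, cₙ; d)` is `P.Op c d`. The action of the symmetric groups is `act`; it is
stated for bijections `Fin m ≃ Fin n` (so that `m = n`) and up to equality of colours, in order
to avoid casts. `comp` is the total composition `f ∘ (g₁, …, gₙ)`, whose inputs are those of
`g₁, …, gₙ` in lexicographic order. -/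
structure Operad where
  /-- the objects, or colours -/
  Ob : Type u
  /-- the operations -/
  Op : {n : ℕ} → (Fin n → Ob) → Ob → Type v
  /-- the identities -/
  one : (c : Ob) → Op (fun _ : Fin 1 => c) c
  /-- the action of the symmetric groups -/
  act : {m n : ℕ} → {c : Fin n → Ob} → {c' : Fin m → Ob} → {d : Ob} → (σ : Fin m ≃ Fin n) →
    (∀ i, c' i = c (σ i)) → Op c d → Op c' d
  /-- total composition -/
  comp : {n : ℕ} → {m : Fin n → ℕ} → {c : Fin n → Ob} → {d : Ob} →
    {b : ∀ i, Fin (m i) → Ob} → Op c d → (∀ i, Op (b i) (c i)) →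
    Op (fun p : Fin (∑ i, m i) => b (finSigmaFinEquiv.symm p).1 (finSigmaFinEquiv.symm p).2) d
  act_refl : ∀ {n : ℕ} {c : Fin n → Ob} {d : Ob} (f : Op c d),
    act (Equiv.refl _) (fun _ => rfl) f = f
  act_trans : ∀ {k m n : ℕ} {c : Fin n → Ob} {c' : Fin m → Ob} {c'' : Fin k → Ob} {d : Ob}
    (τ : Fin k ≃ Fin m) (σ : Fin m ≃ Fin n) (hτ : ∀ i, c'' i = c' (τ i))
    (hσ : ∀ i, c' i = c (σ i)) (f : Op c d),
    act τ hτ (act σ hσ f) = act (τ.trans σ) (fun i => (hτ i).trans (hσ (τ i))) f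
  one_comp : ∀ {m : ℕ} {c : Fin m → Ob} {d : Ob} (f : Op c d),
    comp (one d) (fun _ => f) = act (oneCompEquiv m) (fun _ => rfl) f
  comp_one : ∀ {n : ℕ} {c : Fin n → Ob} {d : Ob} (f : Op c d),
    comp f (fun i => one (c i)) = act (compOneEquiv n) (fun _ => rfl) f
  assoc : ∀ {n : ℕ} {m : Fin n → ℕ} {l : ∀ i, Fin (m i) → ℕ} {c : Fin n → Ob} {d : Ob}
    {b : ∀ i, Fin (m i) → Ob} {a : ∀ i j, Fin (l i j) → Ob}
    (f : Op c d) (g : ∀ i, Op (b i) (c i)) (h : ∀ i j, Op (a i j) (b i j)),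
    comp (comp f g) (fun p => h (finSigmaFinEquiv.symm p).1 (finSigmaFinEquiv.symm p).2) =
      act (assocEquiv m l) (fun p => congrArg (fun q : (Σ i, Σ j, Fin (l i j)) =>
          a q.1 q.2.1 q.2.2) (assocEquiv_spec m l p).symm)
        (comp f (fun i => comp (g i) (h i)))
  act_comp : ∀ {n n' : ℕ} {m : Fin n → ℕ} {c : Fin n → Ob} {d : Ob}
    {b : ∀ i, Fin (m i) → Ob} (σ : Fin n' ≃ Fin n) (f : Op c d) (g : ∀ i, Op (b i) (c i)),
    comp (act (c' := fun i => c (σ i)) σ (fun _ => rfl) f) (fun i => g (σ i)) =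
      act (blockEquiv m σ) (fun p => congrArg (fun q : (Σ i, Fin (m i)) => b q.1 q.2)
        (blockEquiv_spec m σ p).symm) (comp f g)
  comp_act : ∀ {n : ℕ} {m m' : Fin n → ℕ} {c : Fin n → Ob} {d : Ob}
    {b : ∀ i, Fin (m i) → Ob} (τ : ∀ i, Fin (m' i) ≃ Fin (m i)) (f : Op c d)
    (g : ∀ i, Op (b i) (c i)),
    comp f (fun i => act (c' := fun j => b i (τ i j)) (τ i) (fun _ => rfl) (g i)) =
      act (sumEquiv τ) (fun p => congrArg (fun q : (Σ i, Fin (m i)) => b q.1 q.2)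
        (sumEquiv_spec τ p).symm) (comp f g)

/-- Morphisms of operads. -/
@[ext]
structure Operad.Hom (P : Operad.{u, v}) (Q : Operad.{u', v'}) where
  /-- the map on objects -/
  ob : P.Ob → Q.Ob
  /-- the map on operations -/
  op : ∀ {n : ℕ} {c : Fin n → P.Ob} {d : P.Ob}, P.Op c d → Q.Op (fun i => ob (c i)) (ob d)
  map_one : ∀ c, op (P.one c) = Q.one (ob c)
  map_act : ∀ {m n : ℕ} {c : Fin n → P.Ob} {c' : Fin m → P.Ob} {d : P.Ob} (σ : Fin m ≃ Fin n)
    (h : ∀ i, c' i = c (σ i)) (f : P.Op c d),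
    op (P.act σ h f) = Q.act σ (fun i => congrArg ob (h i)) (op f)
  map_comp : ∀ {n : ℕ} {m : Fin n → ℕ} {c : Fin n → P.Ob} {d : P.Ob}
    {b : ∀ i, Fin (m i) → P.Ob} (f : P.Op c d) (g : ∀ i, P.Op (b i) (c i)),
    op (P.comp f g) = Q.comp (op f) (fun i => op (g i))

/-- The identity morphism of an operad. -/
def Operad.Hom.id (P : Operad.{u, v}) : Operad.Hom P P where
  ob c := c
  op f := f
  map_one _ := rfl
  map_act _ _ _ := rfl
  map_comp _ _ := rfl

/-- The composite `G ∘ F` of morphisms of operads. -/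
def Operad.Hom.comp {P : Operad.{u, v}} {Q : Operad.{u', v'}} {R : Operad.{u'', v''}}
    (F : Operad.Hom P Q) (G : Operad.Hom Q R) : Operad.Hom P R where
  ob c := G.ob (F.ob c)
  op f := G.op (F.op f)
  map_one c := by rw [F.map_one, G.map_one]
  map_act σ h f := by rw [F.map_act, G.map_act]
  map_comp f g := by rw [F.map_comp, G.map_comp]

/-- The category of operads. -/
instance : Category Operad.{u, v} where
  Hom P Q := Operad.Hom P Q
  id P := Operad.Hom.id P
  comp F G := Operad.Hom.comp F G

/-! ### Trees -/

/-- A finite rooted (non-planar) tree, encoded by its poset of edges, where `e ≤ f` means that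
the path from `e` to the root contains `f`, and by the set of those minimal edges which are
leaves. The vertices of the tree correspond to the edges which are not leaves (a vertex
corresponds to its output edge); the inputs of the vertex with output `e` are the edges covered
by `e`. The minimal edges that are not leaves are the output edges of the stumps. Taking
the set of edges to be some `Fin card` makes trees a small set, which still contains every
finite rooted tree up to isomorphism. -/
structure Tree where
  /-- the number of edges -/
  card : ℕ
  /-- the order on edges -/
  le : Fin card → Fin card → Prop
  le_refl : ∀ e, le e e
  le_trans : ∀ a b c, le a b → le b c → le a c
  le_antisymm : ∀ a b, le a b → le b a → a = b
  /-- the root -/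
  root : Fin card
  le_root : ∀ e, le e root
  /-- there is only one path from an edge to the root -/
  le_total_above : ∀ e a b, le e a → le e b → le a b ∨ le b a
  /-- the leaves -/
  leaves : Set (Fin card)
  leaves_minimal : ∀ l ∈ leaves, ∀ e, le e l → e = l

namespace Tree

/-- The set of edges of a tree. -/
def E (T : Tree) : Type := Fin T.card

instance (T : Tree) : Fintype T.E := inferInstanceAs (Fintype (Fin T.card))

instance (T : Tree) : PartialOrder T.E where
  le := T.le
  le_refl := T.le_refl
  le_trans := T.le_trans
  le_antisymm := T.le_antisymm

/-- The root edge. -/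
def r (T : Tree) : T.E := T.root

/-- The set of leaves. -/
def L (T : Tree) : Set T.E := T.leaves

/-- `T.IsSubtree A e`: there is a subtree of `T` with set of leaves `A` and root `e`. Such a
subtree is either the single edge `e`, or consists of the vertex with output `e` together with
a subtree grafted on each of its inputs. -/
inductive IsSubtree (T : Tree) : Set T.E → T.E → Prop
  | edge (e : T.E) : IsSubtree T {e} e
  | graft (e : T.E) (he : e ∉ T.L) (A : T.E → Set T.E)
      (hA : ∀ i, i ⋖ e → IsSubtree T (A i) i) : IsSubtree T {x | ∃ i, i ⋖ e ∧ x ∈ A i} e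

theorem IsSubtree.le {T : Tree} {A : Set T.E} {e : T.E} (h : T.IsSubtree A e) :
    ∀ x ∈ A, x ≤ e := by
  induction h with
  | edge e => rintro x rfl; exact le_rfl
  | graft e he A hA ih =>
    rintro x ⟨i, hi, hx⟩
    exact (ih i hi x hx).trans hi.le

theorem eq_of_covBy {T : Tree} {i j e z : T.E} (hi : i ⋖ e) (hj : j ⋖ e) (h : z ≤ i)
    (h' : z ≤ j) : i = j := by
  rcases T.le_total_above z i j h h' with hij | hij
  · exact eq_of_le_of_not_lt (α := T.E) hij fun hlt => hi.2 hlt hj.1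
  · exact (eq_of_le_of_not_lt (α := T.E) hij fun hlt => hj.2 hlt hi.1).symm

/-- Distinct leaves of a subtree are incomparable; indeed nothing lies below both. -/
theorem IsSubtree.eq_of_le {T : Tree} {A : Set T.E} {e : T.E} (h : T.IsSubtree A e) :
    ∀ x ∈ A, ∀ y ∈ A, ∀ z, z ≤ x → z ≤ y → x = y := by
  induction h with
  | edge e => rintro x rfl y rfl _ _ _; rfl
  | graft e he A hA ih =>
    rintro x ⟨i, hi, hx⟩ y ⟨j, hj, hy⟩ z hzx hzy
    obtain rfl := eq_of_covBy hi hj (hzx.trans ((hA i hi).le x hx))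
      (hzy.trans ((hA j hj).le y hy))
    exact ih i hi x hx y hy z hzx hzy

/-- Grafting of subtrees. -/
theorem IsSubtree.bind {T : Tree} {A : Set T.E} {e : T.E} (h : T.IsSubtree A e)
    (B : T.E → Set T.E) (hB : ∀ x ∈ A, T.IsSubtree (B x) x) :
    T.IsSubtree {y | ∃ x ∈ A, y ∈ B x} e := by
  induction h with
  | edge e =>
    have : {y | ∃ x ∈ ({e} : Set T.E), y ∈ B x} = B e := by ext y; simp
    rw [this]
    exact hB e rfl
  | graft e he A hA ih =>
    have : {y | ∃ x ∈ {x | ∃ i, i ⋖ e ∧ x ∈ A i}, y ∈ B x} =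
        {y | ∃ i, i ⋖ e ∧ y ∈ {y | ∃ x ∈ A i, y ∈ B x}} := by
      ext y
      constructor
      · rintro ⟨x, ⟨i, hi, hx⟩, hy⟩
        exact ⟨i, hi, x, hx, hy⟩
      · rintro ⟨i, hi, x, hx, hy⟩
        exact ⟨x, ⟨i, hi, hx⟩, hy⟩
    rw [this]
    exact IsSubtree.graft e he _ fun i hi => ih i hi fun x hx => hB x ⟨i, hi, hx⟩

/-- `e₁, …, eₙ` is a repetition-free list of the leaves of a subtree with root `e`. -/
def IsOp (T : Tree) {n : ℕ} (c : Fin n → T.E) (e : T.E) : Prop :=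
  Function.Injective c ∧ T.IsSubtree (Set.range c) e

theorem IsOp.one (T : Tree) (e : T.E) : T.IsOp (fun _ : Fin 1 => e) e :=
  ⟨fun _ _ _ => Subsingleton.elim _ _, by simpa using IsSubtree.edge e⟩

theorem IsOp.act {T : Tree} {m n : ℕ} {c : Fin n → T.E} {c' : Fin m → T.E} {e : T.E}
    (σ : Fin m ≃ Fin n) (h : ∀ i, c' i = c (σ i)) (hc : T.IsOp c e) : T.IsOp c' e := by
  obtain rfl : c' = c ∘ σ := funext h
  exact ⟨hc.1.comp σ.injective, by rw [EquivLike.range_comp]; exact hc.2⟩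

theorem IsOp.comp {T : Tree} {n : ℕ} {m : Fin n → ℕ} {c : Fin n → T.E} {d : T.E}
    {b : ∀ i, Fin (m i) → T.E} (hc : T.IsOp c d) (hb : ∀ i, T.IsOp (b i) (c i)) :
    T.IsOp (fun p : Fin (∑ i, m i) =>
      b (finSigmaFinEquiv.symm p).1 (finSigmaFinEquiv.symm p).2) d := by
  constructor
  · have key : Function.Injective (fun q : (Σ i, Fin (m i)) => b q.1 q.2) := by
      rintro ⟨i, j⟩ ⟨i', j'⟩ h
      simp only at h
      have h1 := (hb i).2.le _ ⟨j, rfl⟩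
      have h2 := (hb i').2.le _ ⟨j', rfl⟩
      rw [← h] at h2
      obtain rfl := hc.1 (hc.2.eq_of_le _ ⟨i, rfl⟩ _ ⟨i', rfl⟩ _ h1 h2)
      obtain rfl := (hb i).1 h
      rfl
    exact key.comp finSigmaFinEquiv.symm.injective
  · classical
    have := hc.2.bind (fun x => {y | ∃ i, c i = x ∧ y ∈ Set.range (b i)}) (by
      rintro _ ⟨i, rfl⟩
      have : {y | ∃ i', c i' = c i ∧ y ∈ Set.range (b i')} = Set.range (b i) := by
        ext y
        constructor
        · rintro ⟨i', hi', hy⟩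
          obtain rfl := hc.1 hi'
          exact hy
        · exact fun hy => ⟨i, rfl, hy⟩
      rw [this]
      exact (hb i).2)
    convert this using 1
    ext y
    constructor
    · rintro ⟨p, rfl⟩
      exact ⟨_, ⟨(finSigmaFinEquiv.symm p).1, rfl⟩, _, rfl, _, rfl⟩
    · rintro ⟨_, ⟨_, rfl⟩, i, _, j, rfl⟩
      exact ⟨finSigmaFinEquiv ⟨i, j⟩, congrArg (fun q : (Σ i, Fin (m i)) => b q.1 q.2)
        (finSigmaFinEquiv.symm_apply_apply _)⟩

/-- The operad `Ω(T)` of a tree: its objects are the edges of `T`, and there is exactly one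
operation `(e₁, …, eₙ) → e` if there is a subtree of `T` with leaves `e₁, …, eₙ` and root `e`,
and none otherwise. -/
def operad (T : Tree) : Operad.{0, 0} where
  Ob := T.E
  Op c e := PLift (T.IsOp c e)
  one e := ⟨IsOp.one T e⟩
  act σ h f := ⟨f.down.act σ h⟩
  comp f g := ⟨f.down.comp fun i => (g i).down⟩
  act_refl _ := rfl
  act_trans _ _ _ _ _ := rfl
  one_comp _ := rfl
  comp_one _ := rfl
  assoc _ _ _ := rfl
  act_comp _ _ _ := rfl
  comp_act _ _ _ := rfl

/-- The dendroidal category `Ω`: a morphism of trees is a morphism of the associated operads. -/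
instance : Category.{0} Tree where
  Hom S T := Operad.Hom S.operad T.operad
  id T := Operad.Hom.id T.operad
  comp f g := Operad.Hom.comp f g

/-- The map on edges of a morphism of trees. -/
def edge {S T : Tree} (f : S ⟶ T) : S.E → T.E := Operad.Hom.ob f

theorem edge_comp {S T R : Tree} (f : S ⟶ T) (g : T ⟶ R) (e : S.E) :
    edge (f ≫ g) e = edge g (edge f e) := rfl

theorem isOp_map {S T : Tree} (f : S ⟶ T) {n : ℕ} {c : Fin n → S.E} {e : S.E}
    (h : S.IsOp c e) : T.IsOp (fun i => edge f (c i)) (edge f e) :=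
  (Operad.Hom.op f (c := c) (d := e) (PLift.up h)).down

/-- A morphism of trees is monotone on edges. -/
theorem edge_mono {S T : Tree} (f : S ⟶ T) : Monotone (edge f) := by
  classical
  have key : ∀ x y : S.E, x ⋖ y → edge f x ≤ edge f y := by
    intro x y hxy
    have hy : y ∉ S.L := fun hy => hxy.1.ne (S.leaves_minimal y hy x hxy.1.le)
    let s : Finset S.E := Finset.univ.filter (· ⋖ y)
    let c : Fin s.card → S.E := fun i => (s.equivFin.symm i : S.E)
    have hr : Set.range c = {z | ∃ i, i ⋖ y ∧ z ∈ ({i} : Set S.E)} := by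
      ext z
      constructor
      · rintro ⟨i, rfl⟩
        exact ⟨_, (Finset.mem_filter.1 (s.equivFin.symm i).2).2, rfl⟩
      · rintro ⟨i, hi, rfl⟩
        exact ⟨s.equivFin ⟨z, Finset.mem_filter.2 ⟨Finset.mem_univ _, hi⟩⟩, by simp [c]⟩
    have hc : S.IsOp c y := ⟨Subtype.val_injective.comp s.equivFin.symm.injective, by
      rw [hr]; exact IsSubtree.graft y hy _ fun i _ => IsSubtree.edge i⟩
    obtain ⟨i, hi⟩ : x ∈ Set.range c := by rw [hr]; exact ⟨x, hxy, rfl⟩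
    have := (isOp_map f hc).2.le _ ⟨i, rfl⟩
    rw [← hi]
    exact this
  let : LocallyFiniteOrder S.E := Fintype.toLocallyFiniteOrder
  intro x y hxy
  induction le_iff_reflTransGen_covBy.1 hxy with
  | refl => exact le_rfl
  | tail h1 h2 ih => exact (ih (le_iff_reflTransGen_covBy.2 h1)).trans (key _ _ h2)

end Tree

/-! ### Dendroidal sets and the dendroidal nerve -/

/-- The category of dendroidal sets. -/
abbrev DSet := Treeᵒᵖ ⥤ Type u

/-- The dendroidal nerve of an operad: `T ↦ Op(Ω(T), P)`. -/
def nerveObj (P : Operad.{u, v}) : DSet.{max u v} where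
  obj T := Operad.Hom T.unop.operad P
  map f := ↾fun x => Operad.Hom.comp f.unop x

/-- The dendroidal nerve functor. -/
def nerve : Operad.{u, v} ⥤ DSet.{max u v} where
  obj := nerveObj
  map F := { app := fun _ => ↾fun x => Operad.Hom.comp x F }

/-- A monomorphism `f : X ⟶ Y` of dendroidal sets is normal if, for every tree `T`, the group
of automorphisms of `T` acts freely on the complement of the image of `X_T` in `Y_T`. -/
def IsNormalMono {X Y : DSet.{u}} (f : X ⟶ Y) : Prop :=
  Mono f ∧ ∀ (T : Tree) (y : Y.obj (op T)), y ∉ Set.range (f.app (op T)) →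
    ∀ σ : T ≅ T, Y.map σ.hom.op y = y → σ = Iso.refl T

/-! ### Wide independent maps and the operad of elements -/

/-- A map of forests `S₁ ⊕ … ⊕ Sₙ → R` to a tree, given by its components, is independent
if edges coming from different constituents have incomparable images. -/
def Independent {n : ℕ} {S : Fin n → Tree} {R : Tree} (f : ∀ i, S i ⟶ R) : Prop :=
  ∀ i j, i ≠ j → ∀ (e : (S i).E) (e' : (S j).E),
    ¬ Tree.edge (f i) e ≤ Tree.edge (f j) e' ∧ ¬ Tree.edge (f j) e' ≤ Tree.edge (f i) e

/-- A map of forests `S₁ ⊕ … ⊕ Sₙ → R` to a tree is wide if the set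
`Ω(R)(f(r₁), …, f(rₙ); r)` is non-empty, where `rᵢ` and `r` are the roots of `Sᵢ` and `R`. -/
def Wide {n : ℕ} {S : Fin n → Tree} {R : Tree} (f : ∀ i, S i ⟶ R) : Prop :=
  Nonempty (R.operad.Op (fun i => Tree.edge (f i) (S i).r) R.r)

/-- The elements of a dendroidal set `X`: pairs `(T, α)` of a tree `T` and `α ∈ X_T`, that is,
a map from the representable of `T` to `X`. -/
structure Element (X : DSet.{u}) : Type u where
  /-- the tree -/
  tree : Tree
  /-- the element -/
  elt : X.obj (op tree)

/-- The operations `(S₁, α₁), …, (Sₙ, αₙ) → (R, β)` of the operad of elements: the wide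
independent maps of forests `f : S₁ ⊕ … ⊕ Sₙ → R` such that `β ∘ f = (α₁, …, αₙ)`. If
`nullary` is false then the empty forest (`n = 0`) is not admitted; if `nullary` is true it is
(and the empty forest has a wide map to `R` exactly if `R` has no leaves). -/
@[ext]
structure ElementOp (nullary : Prop) {X : DSet.{u}} {n : ℕ} (c : Fin n → Element X)
    (d : Element X) : Type where
  /-- the components of the map of forests -/
  map : ∀ i, (c i).tree ⟶ d.tree
  nonempty : nullary ∨ n ≠ 0
  independent : Independent map
  wide : Wide map
  w : ∀ i, X.map (map i).op d.elt = (c i).elt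

namespace ElementOp

variable {N : Prop} {X : DSet.{u}}

/-- The identity operation. -/
def one (N : Prop) {X : DSet.{u}} (c : Element X) : ElementOp N (fun _ : Fin 1 => c) c where
  map _ := 𝟙 c.tree
  nonempty := Or.inr one_ne_zero
  independent i j h := (h (Subsingleton.elim i j)).elim
  wide := ⟨c.tree.operad.one c.tree.r⟩
  w _ := by simp

/-- The morphism of trees underlying an equality of elements. -/
def castHom {a b : Element X} (h : a = b) : a.tree ⟶ b.tree :=
  eqToHom (congrArg Element.tree h)

theorem castHom_w {a b : Element X} (h : a = b) : X.map (castHom h).op b.elt = a.elt := by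
  subst h; simp [castHom]

theorem castHom_r {a b : Element X} (h : a = b) :
    Tree.edge (castHom h) a.tree.r = b.tree.r := by
  subst h; rfl

@[simp]
theorem castHom_refl {a : Element X} (h : a = a) : castHom h = 𝟙 a.tree := rfl

/-- Permutation of the constituents of the source. -/
def act {m n : ℕ} {c : Fin n → Element X} {c' : Fin m → Element X} {d : Element X}
    (σ : Fin m ≃ Fin n) (h : ∀ i, c' i = c (σ i)) (f : ElementOp N c d) :
    ElementOp N c' d where
  map i := castHom (h i) ≫ f.map (σ i)
  nonempty := f.nonempty.imp_right fun hn hm => hn (by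
    subst hm; exact (Fin.equiv_iff_eq.1 ⟨σ⟩).symm)
  independent i j hij e e' := by
    simp only [Tree.edge_comp]
    exact f.independent _ _ (σ.injective.ne hij) _ _
  wide := by
    obtain ⟨x⟩ := f.wide
    exact ⟨d.tree.operad.act σ (fun i => by rw [Tree.edge_comp, castHom_r]) x⟩
  w i := by
    rw [op_comp, Functor.map_comp, comp_apply, f.w, castHom_w]

/-- Composition of operations. -/
def comp {n : ℕ} {m : Fin n → ℕ} {c : Fin n → Element X} {d : Element X}
    {b : ∀ i, Fin (m i) → Element X} (f : ElementOp N c d)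
    (g : ∀ i, ElementOp N (b i) (c i)) :
    ElementOp N (fun p : Fin (∑ i, m i) =>
      b (finSigmaFinEquiv.symm p).1 (finSigmaFinEquiv.symm p).2) d where
  map p := (g (finSigmaFinEquiv.symm p).1).map (finSigmaFinEquiv.symm p).2 ≫
    f.map (finSigmaFinEquiv.symm p).1
  nonempty := by
    by_cases hN : N
    · exact Or.inl hN
    · refine Or.inr fun h => ?_
      have hn : n ≠ 0 := f.nonempty.resolve_left hN
      have i : Fin n := ⟨0, Nat.pos_of_ne_zero hn⟩
      exact (g i).nonempty.resolve_left hN (Finset.sum_eq_zero_iff.1 h i (Finset.mem_univ i))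
  independent := by
    have key : ∀ q q' : (Σ i, Fin (m i)), q ≠ q' → ∀ (e : (b q.1 q.2).tree.E)
        (e' : (b q'.1 q'.2).tree.E),
        ¬ Tree.edge ((g q.1).map q.2 ≫ f.map q.1) e ≤
          Tree.edge ((g q'.1).map q'.2 ≫ f.map q'.1) e' := by
      rintro ⟨i, j⟩ ⟨i', j'⟩ hq e e' hle
      by_cases hi : i = i'
      · subst hi
        have hj : j ≠ j' := fun h => hq (by rw [h])
        obtain ⟨x⟩ := (g i).wide
        have hx := Tree.isOp_map (f.map i) x.down
        have h1 := Tree.edge_mono (f.map i) (Tree.edge_mono ((g i).map j)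
          ((b i j).tree.le_root e))
        have h2 := Tree.edge_mono (f.map i) (Tree.edge_mono ((g i).map j')
          ((b i j').tree.le_root e'))
        exact hj (hx.1 (hx.2.eq_of_le _ ⟨j, rfl⟩ _ ⟨j', rfl⟩ _ h1 (le_trans hle h2)))
      · exact (f.independent i i' hi _ _).1 hle
    intro p p' hp e e'
    have hq := finSigmaFinEquiv.symm.injective.ne hp
    exact ⟨key _ _ hq e e', key _ _ hq.symm e' e⟩
  wide := by
    obtain ⟨x⟩ := f.wide
    have y : ∀ i, d.tree.operad.Op
        (fun j => Tree.edge (f.map i) (Tree.edge ((g i).map j) (b i j).tree.r))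
        (Tree.edge (f.map i) (c i).tree.r) := fun i => ⟨Tree.isOp_map (f.map i)
          (Classical.choice (g i).wide).down⟩
    exact ⟨d.tree.operad.comp x y⟩
  w p := by
    rw [op_comp, Functor.map_comp, comp_apply, f.w, (g _).w]

theorem castHom_comp_eq {ι : Type} {a : ι → Element X} {R : Tree} (F : ∀ q, (a q).tree ⟶ R)
    {q q' : ι} (hq : q = q') (h : a q = a q') : castHom h ≫ F q' = F q := by
  subst hq; simp

end ElementOp

/-- The operad of elements `Ω/X` of a dendroidal set `X`. -/
def elements (nullary : Prop) (X : DSet.{u}) : Operad.{u, 0} where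
  Ob := Element X
  Op c d := ElementOp nullary c d
  one c := ElementOp.one nullary c
  act σ h f := f.act σ h
  comp f g := f.comp g
  act_refl f := by
    ext i
    simp [ElementOp.act]
  act_trans τ σ hτ hσ f := by
    ext i
    simp [ElementOp.act, ElementOp.castHom]
  one_comp f := by
    ext i
    simp [ElementOp.act, ElementOp.comp, ElementOp.one]
    rfl
  comp_one f := by
    ext i
    simp [ElementOp.act, ElementOp.comp, ElementOp.one]
    rfl
  assoc {n m l c d b a} f g h := by
    ext p
    refine Eq.trans ?_ (ElementOp.castHom_comp_eq (ι := Σ i, Σ j, Fin (l i j))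
      (a := fun q => a q.1 q.2.1 q.2.2)
      (fun q => ((h q.1 q.2.1).map q.2.2 ≫ (g q.1).map q.2.1) ≫ f.map q.1)
      (assocEquiv_spec m l p).symm _).symm
    exact (Category.assoc _ _ _).symm
  act_comp {n n' m c d b} σ f g := by
    ext p
    refine Eq.trans ?_ (ElementOp.castHom_comp_eq (ι := Σ i, Fin (m i))
      (a := fun q => b q.1 q.2) (fun q => (g q.1).map q.2 ≫ f.map q.1)
      (blockEquiv_spec m σ p).symm _).symm
    simp [ElementOp.act, ElementOp.comp]
  comp_act {n m m' c d b} τ f g := by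
    ext p
    refine Eq.trans ?_ (ElementOp.castHom_comp_eq (ι := Σ i, Fin (m i))
      (a := fun q => b q.1 q.2) (fun q => (g q.1).map q.2 ≫ f.map q.1)
      (sumEquiv_spec τ p).symm _).symm
    simp [ElementOp.act, ElementOp.comp]

theorem elt_map {X Y : DSet.{u}} (φ : X ⟶ Y) {S R : Tree} (f : S ⟶ R) (β : X.obj (op R)) :
    Y.map f.op (φ.app _ β) = φ.app _ (X.map f.op β) :=
  (NatTrans.naturality_apply φ f.op β).symm

/-- The functor `X ↦ Ω/X`; a map `φ : X ⟶ Y` sends `(T, α)` to `(T, φ ∘ α)` and leaves the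
underlying maps of forests unchanged. -/
def elementsFunctor (nullary : Prop) : DSet.{u} ⥤ Operad.{u, 0} where
  obj X := elements nullary X
  map φ :=
    { ob := fun c => ⟨c.tree, φ.app _ c.elt⟩
      op := fun f =>
        { map := f.map
          nonempty := f.nonempty
          independent := f.independent
          wide := f.wide
          w := fun i => (elt_map φ (f.map i) _).trans (congrArg _ (f.w i)) }
      map_one := fun _ => rfl
      map_act := fun _ _ _ => rfl
      map_comp := fun _ _ => rfl }
  map_id _ := rfl
  map_comp _ _ := rfl

/-- The endofunctor `X ↦ N_d(Ω/X)` of the category of dendroidal sets. -/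
def nerveElements (nullary : Prop) : DSet.{u} ⥤ DSet.{u} :=
  elementsFunctor.{u} nullary ⋙ nerve.{u, 0}

end Dendroidal

/-! The point is that a map `Ω(T) → Ω/X` amounts to two independent pieces of data: its underlying
map `F : Ω(T) → Ω/1`, and one element `β` of `X` over the tree `F(r_T)`. Composing the components of
`F` on the vertices between an edge `e` and the root gives a morphism `toRoot F e : F(e) → F(r_T)`.
The element over `F(e)` has to be the restriction of `β` along it, and conversely these restrictions
always fit together (`map_comp_toRoot`). Paths in a tree are unique, so any two composites along the
same path agree (`IsPath.unique`, `IsPath.of_isOp`).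

Hence `N_d(Ω/X)_T` is the coproduct over `F` of the sets `X(F(r_T))`, naturally in `X`
(`homElementsEquiv`). Evaluations and coproducts preserve colimits, which gives cocontinuity, and
the Kan extension property follows by density of representables. The same formula shows that
monomorphisms are preserved.

For normality, `Aut(T)` acts freely on all of `N_d(Ω/X)_T`: independence forces distinct inputs of a
vertex to have distinct root images, so an automorphism fixing `F` fixes every edge, by induction
away from the root (`eq_refl_of_comp_eq`). -/

namespace Dendroidal

open Dendroidal.Tree

/-! ### Corollas -/

namespace Tree

variable (T : Tree)

/-- The number of inputs of the vertex with output `e`. -/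
noncomputable def valence (e : T.E) : ℕ := Nat.card {i : T.E // i ⋖ e}

/-- An enumeration of the inputs of the vertex with output `e`. -/
noncomputable def inputEquiv (e : T.E) : Fin (T.valence e) ≃ {i : T.E // i ⋖ e} :=
  (Finite.equivFin _).symm

/-- The inputs of the vertex with output `e`. -/
noncomputable def input (e : T.E) (k : Fin (T.valence e)) : T.E := (T.inputEquiv e k).1

variable {T}

theorem input_covBy (e : T.E) (k : Fin (T.valence e)) : T.input e k ⋖ e := (T.inputEquiv e k).2

theorem input_injective (e : T.E) : Function.Injective (T.input e) :=
  Subtype.val_injective.comp (T.inputEquiv e).injective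

theorem exists_input {x e : T.E} (h : x ⋖ e) : ∃ k, T.input e k = x :=
  ⟨(T.inputEquiv e).symm ⟨x, h⟩, by simp [input]⟩

theorem range_input (e : T.E) : Set.range (T.input e) = {x | x ⋖ e} := by
  ext x
  constructor
  · rintro ⟨k, rfl⟩
    exact input_covBy e k
  · exact exists_input

theorem isOp_input (e : T.E) (he : e ∉ T.L) : T.IsOp (T.input e) e := by
  refine ⟨input_injective e, ?_⟩
  have h := IsSubtree.graft e he (fun i => {i}) fun i _ => IsSubtree.edge i
  convert h using 1
  ext x
  simp [range_input]

theorem notMem_leaves_of_covBy {x e : T.E} (h : x ⋖ e) : e ∉ T.L :=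
  fun he => h.1.ne (T.leaves_minimal e he x h.1.le)

theorem reflTransGen_covBy {x e : T.E} (h : x ≤ e) : Relation.ReflTransGen (· ⋖ ·) x e := by
  classical
  let : LocallyFiniteOrder T.E := Fintype.toLocallyFiniteOrder
  exact le_iff_reflTransGen_covBy.1 h

end Tree

theorem map_op_comp_apply (X : DSet.{u}) {S R Q : Tree} (f : S ⟶ R) (g : R ⟶ Q)
    (x : X.obj (op Q)) : X.map (f ≫ g).op x = X.map f.op (X.map g.op x) := by
  rw [op_comp, Functor.map_comp, comp_apply]

/-! ### Maps from the operad of a tree to an operad of elements -/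

section Path

variable {N : Prop} {X : DSet.{u}} {T : Tree} (F : Operad.Hom T.operad (elements N X))

/-- The composites of the morphisms that `F` assigns to the vertices on the path from `x`
to `e`. -/
inductive IsPath : (x e : T.E) → ((F.ob x).tree ⟶ (F.ob e).tree) → Prop
  | refl (e : T.E) : IsPath e e (𝟙 _)
  | step (e : T.E) (he : e ∉ T.L) (k : Fin (T.valence e)) (x : T.E)
      (m : (F.ob x).tree ⟶ (F.ob (T.input e k)).tree) (hm : IsPath x (T.input e k) m) :
      IsPath x e (m ≫ ElementOp.map (F.op (PLift.up (isOp_input e he))) k)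

variable {F}

namespace IsPath

theorem le {x e : T.E} {m : (F.ob x).tree ⟶ (F.ob e).tree} (h : IsPath F x e m) : x ≤ e := by
  induction h with
  | refl e => exact le_rfl
  | step e he k x m hm ih => exact ih.trans (input_covBy e k).le

/-- Two inputs of `e` that both lie above `x` coincide, so the last step of a path is determined; a
trivial path cannot compete with a step, which would give `x < e`. -/
theorem unique {x e : T.E} {m m' : (F.ob x).tree ⟶ (F.ob e).tree} (h : IsPath F x e m)
    (h' : IsPath F x e m') : m = m' := by
  induction h with
  | refl e =>
    cases h' with
    | refl => rfl
    | step _ he k _ m hm => exact absurd (hm.le.trans_lt (input_covBy e k).lt) (lt_irrefl _)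
  | step e he k x m hm ih =>
    cases h' with
    | refl => exact absurd (hm.le.trans_lt (input_covBy _ k).lt) (lt_irrefl _)
    | step _ _ k' _ m' hm' =>
      obtain rfl := input_injective e
        (eq_of_covBy (input_covBy e k) (input_covBy e k') hm.le hm'.le)
      rw [ih hm']

theorem trans {x y e : T.E} {m : (F.ob x).tree ⟶ (F.ob y).tree}
    {m' : (F.ob y).tree ⟶ (F.ob e).tree} (h : IsPath F x y m) (h' : IsPath F y e m') :
    IsPath F x e (m ≫ m') := by
  induction h' with
  | refl e => simpa using h
  | step e he k y m' hm' ih =>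
    rw [← Category.assoc]
    exact .step e he k x _ (ih h)

/-- Absorbs the `castHom` that the action of bijections in `Ω/X` puts in front of each component. -/
theorem castHom_comp {x y e : T.E} (hxy : F.ob x = F.ob y) (hxy' : x = y)
    {m : (F.ob y).tree ⟶ (F.ob e).tree} (h : IsPath F y e m) :
    IsPath F x e (ElementOp.castHom hxy ≫ m) := by
  subst hxy'
  exact (congrArg (IsPath F x e) (Category.id_comp m)).mpr h

theorem exists_of_reflTransGen {x e : T.E} (h : Relation.ReflTransGen (· ⋖ ·) x e) :
    ∃ m, IsPath F x e m := by
  induction h with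
  | refl => exact ⟨_, .refl _⟩
  | tail h1 h2 ih =>
    obtain ⟨k, rfl⟩ := exists_input h2
    obtain ⟨m, hm⟩ := ih
    exact ⟨_, .step _ (notMem_leaves_of_covBy h2) k _ _ hm⟩

theorem exists_of_le {x e : T.E} (h : x ≤ e) : ∃ m, IsPath F x e m :=
  exists_of_reflTransGen (reflTransGen_covBy h)

/-- The components of the value of `F` on an operation. -/
theorem of_isOp {A : Set T.E} {e : T.E} (hA : T.IsSubtree A e) : ∀ {n : ℕ} {c : Fin n → T.E}
    (hc : T.IsOp c e) (_ : Set.range c = A) (i : Fin n),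
    IsPath F (c i) e (ElementOp.map (F.op (PLift.up hc)) i) := by
  induction hA with
  | edge e =>
    intro n c hc hr i
    -- The list `c` has the single entry `e`, so the operation is a reindexed identity.
    have hce : ∀ i, c i = e := fun i => by
      have : c i ∈ Set.range c := ⟨i, rfl⟩
      rwa [hr] at this
    have : Subsingleton (Fin n) := ⟨fun i j => hc.1 ((hce i).trans (hce j).symm)⟩
    let : Unique (Fin n) := ⟨⟨i⟩, fun j => Subsingleton.elim _ _⟩
    have key := (F.map_act (Equiv.ofUnique (Fin n) (Fin 1)) (c := fun _ => e) hce
      (T.operad.one e)).trans (congrArg ((elements N X).act _ _) (F.map_one e))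
    have key' : ElementOp.map (F.op (PLift.up hc)) i =
        ElementOp.castHom (congrArg F.ob (hce i)) ≫ 𝟙 _ :=
      congrArg (fun f => ElementOp.map f i) key
    rw [key']
    exact castHom_comp _ (hce i) (.refl e)
  | graft e he A hA ih =>
    intro n c hc hr i
    -- The operation is rebuilt as the corolla at `e` composed with operations `b k` enumerating the
    -- leaves of the branches; `σ` compares the resulting order of the leaves with that of `c`.
    let m : Fin (T.valence e) → ℕ := fun k => Nat.card (A (T.input e k))
    let b : ∀ k, Fin (m k) → T.E := fun k j => ((Finite.equivFin (A (T.input e k))).symm j).1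
    have hbr : ∀ k, Set.range (b k) = A (T.input e k) := fun k =>
      ((Finite.equivFin (A (T.input e k))).symm.surjective.range_comp _).trans Subtype.range_coe
    have hb : ∀ k, T.IsOp (b k) (T.input e k) := fun k =>
      ⟨Subtype.val_injective.comp (Equiv.injective _), by
        rw [hbr]; exact hA _ (input_covBy e k)⟩
    let c' : Fin (∑ k, m k) → T.E :=
      fun p => b (finSigmaFinEquiv.symm p).1 (finSigmaFinEquiv.symm p).2
    have hc' : T.IsOp c' e := (isOp_input e he).comp hb
    have hr' : Set.range c = Set.range c' := by
      rw [hr]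
      ext x
      constructor
      · rintro ⟨i, hi, hx⟩
        obtain ⟨k, rfl⟩ := exists_input hi
        rw [← hbr] at hx
        obtain ⟨j, rfl⟩ := hx
        exact ⟨finSigmaFinEquiv ⟨k, j⟩, congrArg (fun q : (Σ i, Fin (m i)) => b q.1 q.2)
          (finSigmaFinEquiv.symm_apply_apply _)⟩
      · rintro ⟨p, rfl⟩
        refine ⟨_, input_covBy e (finSigmaFinEquiv.symm p).1, ?_⟩
        rw [← hbr]
        exact ⟨_, rfl⟩
    let σ : Fin n ≃ Fin (∑ k, m k) := (Equiv.ofInjective c hc.1).trans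
      ((Equiv.setCongr hr').trans (Equiv.ofInjective c' hc'.1).symm)
    have hσ : ∀ i, c i = c' (σ i) := fun i =>
      (congrArg Subtype.val ((Equiv.ofInjective c' hc'.1).apply_symm_apply
        ((Equiv.setCongr hr') (Equiv.ofInjective c hc.1 i)))).symm
    -- Operations of `Ω(T)` are proofs, so the rebuilt operation is definitionally the given one.
    have key := (F.map_act (c := c') σ hσ
      (T.operad.comp (d := e) (PLift.up (isOp_input e he)) fun k => PLift.up (hb k))).trans
      (congrArg ((elements N X).act _ _) (F.map_comp _ _))
    have key' := congrArg (fun f => ElementOp.map f i) key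
    refine (congrArg (IsPath F (c i) e) key').mpr ?_
    exact castHom_comp _ (hσ i) (.step e he _ _ _ (ih _ (input_covBy e _) (hb _) (hbr _) _))

end IsPath

variable (F)

/-- The composite of the morphisms that `F` assigns to the vertices on the path from `e` to the
root. -/
noncomputable def toRoot (e : T.E) : (F.ob e).tree ⟶ (F.ob T.r).tree :=
  (IsPath.exists_of_le (F := F) (T.le_root e)).choose

theorem isPath_toRoot (e : T.E) : IsPath F e T.r (toRoot F e) :=
  (IsPath.exists_of_le (F := F) (T.le_root e)).choose_spec

theorem toRoot_root : toRoot F T.r = 𝟙 _ := (isPath_toRoot F T.r).unique (.refl _)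

/-- Both sides are composites along the path from `c i` to the root. -/
theorem map_comp_toRoot {n : ℕ} {c : Fin n → T.E} {e : T.E} (f : T.operad.Op c e) (i : Fin n) :
    ElementOp.map (F.op f) i ≫ toRoot F e = toRoot F (c i) :=
  ((IsPath.of_isOp f.down.2 f.down rfl i).trans (isPath_toRoot F e)).unique
    (isPath_toRoot F (c i))

end Path

/-! ### Lifting maps along `Ω/X → Ω/1` -/

section Lift

variable {N : Prop} {X Y : DSet.{u}} {P : Operad.{0, 0}}

/-- The lift along elements of `X` of a map to an operad of elements. -/
def liftHom (F : Operad.Hom P (elements N Y)) (s : ∀ c, X.obj (op (F.ob c).tree))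
    (hs : ∀ {n : ℕ} {c : Fin n → P.Ob} {d : P.Ob} (f : P.Op c d) (i : Fin n),
      X.map (ElementOp.map (F.op f) i).op (s d) = s (c i)) :
    Operad.Hom P (elements N X) where
  ob c := ⟨(F.ob c).tree, s c⟩
  op f :=
    { map := ElementOp.map (X := Y) (F.op f)
      nonempty := ElementOp.nonempty (X := Y) (F.op f)
      independent := ElementOp.independent (X := Y) (F.op f)
      wide := ElementOp.wide (X := Y) (F.op f)
      w := hs f }
  -- An operation of elements is determined by its morphisms of trees, which the lift does not
  -- change, so each law is inherited from `F`.
  map_one c := ElementOp.ext (congrArg (ElementOp.map (X := Y)) (F.map_one c))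
  map_act σ h f := ElementOp.ext (congrArg (ElementOp.map (X := Y)) (F.map_act σ h f))
  map_comp f g := ElementOp.ext (congrArg (ElementOp.map (X := Y)) (F.map_comp f g))

theorem liftHom_congr (F : Operad.Hom P (elements N Y)) {s s' : ∀ c, X.obj (op (F.ob c).tree)}
    (h : s = s') (hs hs') : liftHom (N := N) F s hs = liftHom F s' hs' := by
  subst h; rfl

end Lift

/-- The terminal dendroidal set. -/
abbrev terminalDSet : DSet.{u} := (Functor.const _).obj PUnit.{u + 1}

/-- The map to the terminal dendroidal set. -/
def toTerminal (X : DSet.{u}) : X ⟶ terminalDSet.{u} where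
  app _ := ↾fun _ => PUnit.unit

variable {N : Prop} {T : Tree}

/-- The underlying map to `Ω/1` of a map to `Ω/X`. -/
def forgetElements {P : Operad.{0, 0}} {X : DSet.{u}} (x : Operad.Hom P (elements N X)) :
    Operad.Hom P (elements N terminalDSet.{u}) :=
  x.comp ((elementsFunctor N).map (toTerminal X))

/-- Iterates the condition `w` along the path; with the target at the root, the root element
determines all others. -/
theorem IsPath.map_elt {X : DSet.{u}} (x : Operad.Hom T.operad (elements N X)) {e e' : T.E}
    {m : ((forgetElements x).ob e).tree ⟶ ((forgetElements x).ob e').tree}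
    (h : IsPath (forgetElements x) e e' m) :
    X.map m.op (x.ob e').elt = (x.ob e).elt := by
  induction h with
  | refl e => exact X.map_id_apply _ _
  | step e he k y m hm ih =>
    exact (map_op_comp_apply X _ _ _).trans ((congrArg (X.map m.op)
      (ElementOp.w (X := X) (x.op (PLift.up (isOp_input e he))) k)).trans ih)

/-- A map `Ω(T) ⟶ Ω/X` amounts to a map `F : Ω(T) ⟶ Ω/1` together with an element of `X` over the
tree that `F` assigns to the root of `T`. -/
noncomputable def homElementsEquiv (N : Prop) (T : Tree) (X : DSet.{u}) :
    Operad.Hom T.operad (elements N X) ≃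
      Σ F : Operad.Hom T.operad (elements N terminalDSet.{u}), X.obj (op (F.ob T.r).tree) where
  toFun x := ⟨forgetElements x, (x.ob T.r).elt⟩
  invFun q := liftHom q.1 (fun e => X.map (toRoot q.1 e).op q.2) fun f i => by
    rw [← map_comp_toRoot q.1 f i]
    exact (map_op_comp_apply X _ _ _).symm
  -- `x` is by definition the lift of `forgetElements x` along its own elements.
  left_inv x := liftHom_congr (forgetElements x) (s' := fun e => (x.ob e).elt)
    (funext fun e => IsPath.map_elt x (isPath_toRoot (forgetElements x) e)) _
    fun f i => ElementOp.w (X := X) (x.op f) i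
  right_inv q := by
    obtain ⟨F, β⟩ := q
    have h : X.map (toRoot F T.r).op β = β := by
      rw [toRoot_root]
      exact X.map_id_apply _ β
    exact congrArg (Sigma.mk F) h

/-! ### Coproducts of evaluations -/

section SigmaEvaluation

variable {C : Type u'} [Category.{v'} C] {I : Type u}

/-- The coproduct of the evaluations at a family of objects. -/
@[simps]
def sigmaEvaluation (R : I → C) : (C ⥤ Type u) ⥤ Type u where
  obj X := Σ i, X.obj (R i)
  map φ := ↾fun x => ⟨x.1, φ.app _ x.2⟩

/-- A cocone under the coproduct is a family of cocones with a common point, one for each summand,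
and each summand is an evaluation, hence cocontinuous. -/
instance (R : I → C) : PreservesColimitsOfSize.{u, u} (sigmaEvaluation R) where
  preservesColimitsOfShape := {
    preservesColimit := fun {K} => {
      preserves := fun {c} hc => ⟨by
        have h := fun i => isColimitOfPreserves ((evaluation C (Type u)).obj (R i)) hc
        let leg (s : Cocone (K ⋙ sigmaEvaluation R)) (i : I) :
            Cocone (K ⋙ (evaluation C (Type u)).obj (R i)) :=
          { pt := s.pt
            ι :=
              { app := fun j => ↾fun x => s.ι.app j ⟨i, x⟩
                naturality := fun j j' f => by
                  ext x
                  exact ConcreteCategory.congr_hom (s.w f) ⟨i, x⟩ } }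
        exact
          { desc := fun s => ↾fun x => (h x.1).desc (leg s x.1) x.2
            fac := fun s j => by
              ext x
              exact ConcreteCategory.congr_hom ((h x.1).fac (leg s x.1) j) x.2
            uniq := fun s m hm => by
              ext x
              refine ConcreteCategory.congr_hom ((h x.1).uniq (leg s x.1)
                (↾fun y => m ⟨x.1, y⟩) fun j => ?_) x.2
              ext y
              exact ConcreteCategory.congr_hom (hm j) ⟨x.1, y⟩ }⟩ } }

end SigmaEvaluation

/-! ### The theorem -/

/-- The functor `X ↦ N_d(Ω/X)_T` is a coproduct of evaluations. -/
noncomputable def nerveElementsEvaluationIso (N : Prop) (T : Tree) :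
    nerveElements.{u} N ⋙ (evaluation _ _).obj (op T) ≅
      sigmaEvaluation fun F : Operad.Hom T.operad (elements N terminalDSet.{u}) =>
        op (F.ob T.r).tree :=
  -- A map `X ⟶ Y` keeps the underlying map to `Ω/1` and acts only on the root element.
  NatIso.ofComponents (fun X => (homElementsEquiv N T X).toIso) fun _ => rfl

instance (N : Prop) : PreservesColimitsOfSize.{u, u} (nerveElements.{u} N) :=
  preservesColimits_of_evaluation _ fun T =>
    preservesColimits_of_natIso (nerveElementsEvaluationIso N T.unop).symm

/-- Through `homElementsEquiv` the map becomes a coproduct of components of `f`. -/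
theorem nerveElements_map_app_injective {X Y : DSet.{u}} (f : X ⟶ Y) [Mono f] (T : Treeᵒᵖ) :
    Function.Injective (((nerveElements.{u} N).map f).app T) := by
  intro x y hxy
  apply (homElementsEquiv N T.unop X).injective
  have hf : ∀ S, Function.Injective (f.app S) := fun S => (mono_iff_injective _).1 inferInstance
  exact (Function.injective_id.sigma_map (β₂ := fun F : Operad.Hom T.unop.operad
    (elements N terminalDSet.{u}) => Y.obj (op (F.ob T.unop.r).tree)) fun F => hf _)
    (a₁ := homElementsEquiv N T.unop X x) (a₂ := homElementsEquiv N T.unop X y) (congrArg (homElementsEquiv N T.unop Y) hxy)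

/-! ### Automorphisms of trees and freeness of their action -/

namespace Tree

theorem edge_hom_inv {S T : Tree} (σ : S ≅ T) (e : S.E) : edge σ.inv (edge σ.hom e) = e := by
  rw [← edge_comp, σ.hom_inv_id]; rfl

theorem edge_inv_hom {S T : Tree} (σ : S ≅ T) (e : T.E) : edge σ.hom (edge σ.inv e) = e :=
  edge_hom_inv σ.symm e

/-- The order isomorphism on edges induced by an isomorphism of trees. -/
def edgeOrderIso {S T : Tree} (σ : S ≅ T) : S.E ≃o T.E where
  toFun := edge σ.hom
  invFun := edge σ.inv
  left_inv := edge_hom_inv σ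
  right_inv := edge_inv_hom σ
  map_rel_iff' {a b} := ⟨fun h => by
    simpa [edge_hom_inv] using edge_mono σ.inv h, fun h => edge_mono σ.hom h⟩

/-- Each set of operations of `Ω(T)` has at most one element. -/
theorem hom_ext {S T : Tree} {f g : S ⟶ T} (h : ∀ e, edge f e = edge g e) : f = g := by
  obtain ⟨fo, fp, _, _, _⟩ := f
  obtain ⟨go, gp, _, _, _⟩ := g
  obtain rfl : fo = go := funext h
  obtain rfl : @fp = @gp := by
    funext n c d x
    exact PLift.down_injective rfl
  rfl

end Tree

/-- The equality is heterogeneous because the two images lie in `F.ob e` and `F.ob e'`, which are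
identified only through `e = e'`. -/
theorem IsPath.edge_root_heq {X : DSet.{u}} {F : Operad.Hom T.operad (elements N X)}
    {x x' e e' : T.E} {m : (F.ob x).tree ⟶ (F.ob e).tree} {m' : (F.ob x').tree ⟶ (F.ob e').tree}
    (h : IsPath F x e m) (h' : IsPath F x' e' m') (hx : x = x') (he : e = e') :
    edge m (F.ob x).tree.r ≍ edge m' (F.ob x').tree.r := by
  subst hx he
  rw [h.unique h']

/-- No non-trivial automorphism of `T` fixes a map `Ω(T) ⟶ Ω/X`. -/
theorem eq_refl_of_comp_eq {X : DSet.{u}} (F : Operad.Hom T.operad (elements N X)) (σ : T ≅ T)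
    (h : Operad.Hom.comp σ.hom F = F) : σ = Iso.refl T := by
  apply Iso.ext
  apply Tree.hom_ext
  intro e
  change edge σ.hom e = e
  induction reflTransGen_covBy (T.le_root e : e ≤ T.r) using
    Relation.ReflTransGen.head_induction_on with
  | refl =>
    exact le_antisymm (T.le_root _) ((edge_inv_hom σ T.r).symm.le.trans
      (edge_mono σ.hom (T.le_root (edge σ.inv T.r))))
  | @head x y hxy _ ih =>
    -- As `σ` fixes `y`, it permutes the inputs of `y`.
    have hσ : edge σ.hom x ⋖ y := by
      have := (apply_covBy_apply_iff (edgeOrderIso σ)).2 hxy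
      change edge σ.hom x ⋖ edge σ.hom y at this
      rwa [ih] at this
    obtain ⟨k, hk⟩ := exists_input hxy
    obtain ⟨k', hk'⟩ := exists_input hσ
    have hp := isOp_input y (notMem_leaves_of_covBy hxy)
    let rootImage (G : Operad.Hom T.operad (elements N X)) (k) : (G.ob y).tree.E :=
      edge (ElementOp.map (X := X) (G.op (PLift.up hp)) k) (G.ob (T.input y k)).tree.r
    have h1 : rootImage (Operad.Hom.comp σ.hom F) k ≍ rootImage F k := by rw [h]
    -- The `k`-th component of `F ∘ σ` on the corolla at `y` is the composite of `F` along the path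
    -- from `σ x`, the `k'`-th input, to `σ y = y`.
    have h2 : rootImage (Operad.Hom.comp σ.hom F) k ≍ rootImage F k' :=
      (IsPath.of_isOp (isOp_map σ.hom hp).2 (isOp_map σ.hom hp) rfl k).edge_root_heq
        (IsPath.of_isOp hp.2 hp rfl k') (by rw [hk, hk']) ih
    have h3 : rootImage F k = rootImage F k' := eq_of_heq (h1.symm.trans h2)
    by_contra hne
    have hkk : k ≠ k' := by
      rintro rfl
      exact hne (hk'.symm.trans hk)
    -- Distinct inputs would have incomparable root images, but these are equal.
    exact (ElementOp.independent (X := X) (F.op (PLift.up hp)) k k' hkk _ _).1 h3.le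

theorem isNormalMono_nerveElements_map {X Y : DSet.{u}} (f : X ⟶ Y) (hf : IsNormalMono f) :
    IsNormalMono ((nerveElements.{u} N).map f) := by
  have := hf.1
  refine ⟨?_, fun T y _ σ hσ => eq_refl_of_comp_eq y σ hσ⟩
  have (T : Treeᵒᵖ) : Mono (((nerveElements.{u} N).map f).app T) :=
    (mono_iff_injective _).2 (nerveElements_map_app_injective f T)
  exact NatTrans.mono_of_mono_app _

end Dendroidal

theorem mainTheorem8 (nullary : Prop) :
    PreservesColimitsOfSize.{u, u} (Dendroidal.nerveElements.{u} nullary) ∧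
    (Dendroidal.nerveElements.{u} nullary).IsLeftKanExtension
      (𝟙 (uliftYoneda.{u} (C := Dendroidal.Tree) ⋙ Dendroidal.nerveElements.{u} nullary)) ∧
    ∀ (X Y : Dendroidal.DSet.{u}) (f : X ⟶ Y), Dendroidal.IsNormalMono f →
      Dendroidal.IsNormalMono ((Dendroidal.nerveElements.{u} nullary).map f) := by
  -- The density colimit of a presheaf runs over its category of elements, whose objects form a
  -- `Type u` and whose morphisms lie in `Type`.
  have : PreservesColimitsOfSize.{0, u} (Dendroidal.nerveElements.{u} nullary) :=
    preservesColimitsOfSize_shrink _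
  exact ⟨inferInstance, Presheaf.isLeftKanExtension_of_preservesColimits.{u} _ (Iso.refl _),
    fun X Y f hf => Dendroidal.isNormalMono_nerveElements_map f hf⟩
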